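/- Let $m\ge 2$ and $N\ge 1$ be coprime integers and let $T\in \mathrm{SL}(m,\mathbb R)$. Write $|v_1,\dots,v_m|$ for the determinant of the matrix with columns $v_1,\dots,v_m\in\mathbb R^m$. A sequence $\gamma:\mathbb Z\to\mathbb R^m$ is *twisted* (of period $N$, with monodromy $T$) if $\gamma_{n+N}=T\gamma_n$ for all $n$; for fixed $T$ the twisted sequences form a vector space, isomorphic to $(\mathbb R^m)^N$ by $\gamma\mapsto(\gamma_0,\dots,\gamma_{N-1})$. Let $$\mathcal M_N^1=\{\gamma \text{ twisted} : d_n(\gamma):=|\gamma_n,\gamma_{n+1},\dots,\gamma_{n+m-1}|=1\ \text{ for all } n\}$$ be the submanifold of arc length parametrized twisted polygons. Its tangent space at $\gamma$ consists of the twisted sequences $X$ (i.e. $X_{n+N}=TX_n$) along which the derivative of every $d_n$ at $\gamma$ vanishes. For $\gamma\in\mathcal M_N^1$ put $a_n^0=(-1)^{m-1}$ and, for $1\le r\le m-1$, let $a_n^r$ be the determinant obtained from $|\gamma_n,\dots,\gamma_{n+m-1}|$ by replacing the column $\gamma_{n+r}$ by $\gamma_{n+m}$, so that $\gamma_{n+m}=\sum_{r=0}^{m-1}a_n^r\gamma_{n+r}$.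 For tangent vectors $X,Y$ at $\gamma$ let $J_n(X)=(-1)^{m-1}\sum_{\ell=0}^{m-1}a_n^\ell X_{n+\ell}$ and define the 2-form $\omega_1$ on $\mathcal M_N^1$ by $$\begin{aligned}\omega_1(X,Y)(\gamma)=\frac12\sum_{n=1}^N\sum_{r=1}^{m-1}\Big(&|J_n(Y),\gamma_{n+1},\dots,X_{n+r},\dots,\gamma_{n+m-1}|-|J_n(X),\gamma_{n+1},\dots,Y_{n+r},\dots,\gamma_{n+m-1}|\\&-|\gamma_n,\dots,X_{n+r-1},\dots,\gamma_{n+m-2},Y_{n+m-1}|+|\gamma_n,\dots,Y_{n+r-1},\dots,\gamma_{n+m-2},X_{n+m-1}|\Big),\end{aligned}$$ where in the first two determinants the vector $X_{n+r}$ (resp. $Y_{n+r}$) replaces the column $\gamma_{n+r}$, and in the last two $X_{n+r-1}$ (resp. $Y_{n+r-1}$) replaces the column $\gamma_{n+r-1}$. Then $\omega_1$ is closed on $\mathcal M_N^1$: $\mathrm d\omega_1|_\gamma(X,Y,Z)=0$ for every $\gamma\in\mathcal M_N^1$ and all tangent vectors $X,Y,Z$ of $\mathcal M_N^1$ at $\gamma$.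 Moreover $\omega_1$ is pre-symplectic, i.e. a closed 2-form with non-trivial kernel: at every $\gamma\in\mathcal M_N^1$ there is a tangent vector $X\neq0$ with $\omega_1(X,Y)(\gamma)=0$ for all tangent vectors $Y$ at $\gamma$. -/

import Mathlib

open scoped ContDiff Matrix MatrixGroups

noncomputable section

namespace CentroAffine

/-- The determinant `|v₀, v₁, …, v_{m-1}|` of the first `m` vectors of a list of vectors of `ℝᵐ`,
taken as columns. -/
def vol {m : ℕ} (v : ℕ → Fin m → ℝ) : ℝ :=
  (Matrix.of fun i j : Fin m => v j i).det

/-- `γ : ℤ → ℝᵐ` is twisted, of period `N` and with monodromy `T`: `γ_{n+N} = T γ_n`. -/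
def IsTwisted {m : ℕ} (N : ℕ) (T : SL(m, ℝ)) (γ : ℤ → Fin m → ℝ) : Prop :=
  ∀ n : ℤ, γ (n + N) = T.1 *ᵥ γ n

/-- The centro-affine arc length `d_n = |γ_n, γ_{n+1}, …, γ_{n+m-1}|`. -/
def arcLength {m : ℕ} (γ : ℤ → Fin m → ℝ) (n : ℤ) : ℝ :=
  vol fun j => γ (n + j)

/-- The space of arc length parametrized twisted polygons in `ℝᵐ` of period `N` and monodromy `T`
(`d_n = 1` contains the non-degeneracy `d_n ≠ 0`). -/
def arcLengthPolygons {m : ℕ} (N : ℕ) (T : SL(m, ℝ)) : Set (ℤ → Fin m → ℝ) :=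
  {γ | IsTwisted N T γ ∧ ∀ n : ℤ, arcLength γ n = 1}

/-- The invariants `a_n^r`: `a_n^0 = (-1)^{m-1}`, and for `1 ≤ r ≤ m-1` the determinant
`|γ_n, …, γ_{n+m-1}|` with its column `γ_{n+r}` replaced by `γ_{n+m}`. -/
def invariant {m : ℕ} (γ : ℤ → Fin m → ℝ) (n : ℤ) (r : ℕ) : ℝ :=
  if r = 0 then (-1) ^ (m - 1)
  else vol (Function.update (fun j => γ (n + j)) r (γ (n + m)))

/-- `J_n(X) = (-1)^{m-1} ∑_{ℓ=0}^{m-1} a_n^ℓ X_{n+ℓ}`. -/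
def J {m : ℕ} (γ X : ℤ → Fin m → ℝ) (n : ℤ) : Fin m → ℝ :=
  (-1 : ℝ) ^ (m - 1) • ∑ l ∈ Finset.range m, invariant γ n l • X (n + l)

/-- `|γ_n, …, γ_{n+m-1}|` with `γ_{n+p}` replaced by `u` and `γ_{n+q}` replaced by `w`. -/
def vol₂ {m : ℕ} (γ : ℤ → Fin m → ℝ) (n : ℤ) (p : ℕ) (u : Fin m → ℝ) (q : ℕ) (w : Fin m → ℝ) : ℝ :=
  vol (Function.update (Function.update (fun j => γ (n + j)) p u) q w)

/-- The value `ω₁(X, Y)(γ)`. Columns are counted from `0` here, so that "position `r + 1`" of the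
first two determinants is column `r`, and "position `r`" of the last two is column `r - 1`. -/
def omega₁ {m : ℕ} (N : ℕ) (γ X Y : ℤ → Fin m → ℝ) : ℝ :=
  (1 / 2) * ∑ n ∈ Finset.Icc (1 : ℤ) N, ∑ r ∈ Finset.Icc 1 (m - 1),
    (vol₂ γ n 0 (J γ Y n) r (X (n + r))
      - vol₂ γ n 0 (J γ X n) r (Y (n + r))
      - vol₂ γ n (r - 1) (X (n + r - 1)) (m - 1) (Y (n + m - 1))
      + vol₂ γ n (r - 1) (Y (n + r - 1)) (m - 1) (X (n + m - 1)))

/-! ### Coordinates on the twisted polygons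

For fixed `T` a twisted polygon is the same as its vertices `γ_0, …, γ_{N-1}`, so the twisted
sequences form a vector space isomorphic to `(ℝᵐ)ᴺ`, on which calculus is done. -/

/-- The vector space `(ℝᵐ)ᴺ` of the `N` free vertices. -/
abbrev Vertices (m N : ℕ) : Type := Fin N → Fin m → ℝ

/-- The position in `{0, …, N-1}` of the residue of `n` modulo `N`. -/
def residue (N : ℕ) [NeZero N] (n : ℤ) : Fin N :=
  ⟨(n % N).toNat, by
    have hN : (0 : ℤ) < N := by exact_mod_cast NeZero.pos N
    have h1 := Int.emod_nonneg n hN.ne'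
    have h2 := Int.emod_lt_of_pos n hN
    omega⟩

/-- The twisted sequence `γ_{kN+i} = T^k x_i` (`0 ≤ i < N`) with monodromy `T` and
vertices `x`. -/
def polygon {m N : ℕ} [NeZero N] (T : SL(m, ℝ)) (x : Vertices m N) (n : ℤ) : Fin m → ℝ :=
  (T ^ (n / (N : ℤ))).1 *ᵥ x (residue N n)

theorem isTwisted_polygon {m N : ℕ} [NeZero N] (T : SL(m, ℝ)) (x : Vertices m N) :
    IsTwisted N T (polygon T x) := by
  intro n
  have hN : (N : ℤ) ≠ 0 := by exact_mod_cast NeZero.ne N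
  have h1 : residue N (n + N) = residue N n := by simp [residue]
  have h2 : (n + N) / (N : ℤ) = 1 + n / N := by
    rw [Int.add_ediv_of_dvd_right (dvd_refl _), Int.ediv_self hN, add_comm]
  simp only [polygon, h1, h2, zpow_add, zpow_one, Matrix.SpecialLinearGroup.coe_mul,
    Matrix.mulVec_mulVec]

/-- Conversely, every twisted sequence is the polygon with its vertices `γ_0, …, γ_{N-1}`. -/
theorem IsTwisted.eq_polygon {m N : ℕ} [NeZero N] {T : SL(m, ℝ)} {γ : ℤ → Fin m → ℝ}
    (h : IsTwisted N T γ) : γ = polygon T fun i : Fin N => γ (i : ℕ) := by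
  have hN : (0 : ℤ) < N := by exact_mod_cast NeZero.pos N
  have key : ∀ (k i : ℤ), γ (i + k * N) = (T ^ k).1 *ᵥ γ i := by
    intro k i
    induction k using Int.induction_on with
    | zero => simp
    | succ k ih =>
      have e : i + ((k : ℤ) + 1) * N = (i + k * N) + N := by ring
      rw [e, h, ih, add_comm (k : ℤ) 1, zpow_add, zpow_one, Matrix.SpecialLinearGroup.coe_mul,
        Matrix.mulVec_mulVec]
    | pred k ih =>
      have e : i + (-(k : ℤ)) * N = (i + (-(k : ℤ) - 1) * N) + N := by ring
      rw [e, h] at ih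
      have e2 : (-(k : ℤ) - 1) = -1 + -(k : ℤ) := by ring
      rw [e2] at ih ⊢
      rw [zpow_add, Matrix.SpecialLinearGroup.coe_mul, ← Matrix.mulVec_mulVec, ← ih,
        Matrix.mulVec_mulVec, ← Matrix.SpecialLinearGroup.coe_mul]
      simp
  funext n
  have h1 := key (n / N) (n % N)
  have h0 := Int.emod_nonneg n hN.ne'
  rw [mul_comm, Int.emod_add_mul_ediv] at h1
  rw [h1]
  simp [polygon, residue, Int.toNat_of_nonneg h0]

theorem polygon_add {m N : ℕ} [NeZero N] (T : SL(m, ℝ)) (x y : Vertices m N) (n : ℤ) :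
    polygon T (x + y) n = polygon T x n + polygon T y n := by
  simp [polygon, Matrix.mulVec_add]

theorem polygon_smul {m N : ℕ} [NeZero N] (T : SL(m, ℝ)) (c : ℝ) (x : Vertices m N) (n : ℤ) :
    polygon T (c • x) n = c • polygon T x n := by
  simp [polygon, Matrix.mulVec_smul]

/-- The tangent space at `x` of the level set `{d_n = 1 for all n}`: the vectors along which all
arc lengths `d_n` have derivative zero, i.e. the arc length preserving directions. -/
def tangent {m N : ℕ} [NeZero N] (T : SL(m, ℝ)) (x : Vertices m N) : Set (Vertices m N) :=
  {X | ∀ n : ℤ, fderiv ℝ (fun y : Vertices m N => arcLength (polygon T y) n) x X = 0}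

/-! ### `ω₁` as a smooth differential form -/

theorem vol_update_add {m : ℕ} (v : ℕ → Fin m → ℝ) {p : ℕ} (hp : p < m) (a b : Fin m → ℝ) :
    vol (Function.update v p (a + b)) =
      vol (Function.update v p a) + vol (Function.update v p b) := by
  have e : ∀ c : Fin m → ℝ, (Matrix.of fun i j : Fin m => Function.update v p c j i) =
      (Matrix.of fun i j : Fin m => v j i).updateCol ⟨p, hp⟩ c := by
    intro c
    ext i j
    by_cases h : (j : ℕ) = p
    · have : j = ⟨p, hp⟩ := Fin.ext h
      subst this
      simp
    · have : j ≠ ⟨p, hp⟩ := fun h' => h (congrArg Fin.val h')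
      simp [h, this]
  simp only [vol, e, Matrix.det_updateCol_add]

theorem vol_update_smul {m : ℕ} (v : ℕ → Fin m → ℝ) {p : ℕ} (hp : p < m) (c : ℝ)
    (a : Fin m → ℝ) : vol (Function.update v p (c • a)) = c * vol (Function.update v p a) := by
  have e : ∀ c : Fin m → ℝ, (Matrix.of fun i j : Fin m => Function.update v p c j i) =
      (Matrix.of fun i j : Fin m => v j i).updateCol ⟨p, hp⟩ c := by
    intro c
    ext i j
    by_cases h : (j : ℕ) = p
    · have : j = ⟨p, hp⟩ := Fin.ext h
      subst this
      simp
    · have : j ≠ ⟨p, hp⟩ := fun h' => h (congrArg Fin.val h')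
      simp [h, this]
  simp only [vol, e, Matrix.det_updateCol_smul]

theorem J_add {m : ℕ} (γ X Y : ℤ → Fin m → ℝ) (n : ℤ) :
    J γ (fun k => X k + Y k) n = J γ X n + J γ Y n := by
  simp only [J, smul_add, Finset.sum_add_distrib]

theorem J_smul {m : ℕ} (γ X : ℤ → Fin m → ℝ) (c : ℝ) (n : ℤ) :
    J γ (fun k => c • X k) n = c • J γ X n := by
  simp only [J, Finset.smul_sum]
  refine Finset.sum_congr rfl fun l _ => ?_
  simp only [smul_smul]
  congr 1
  ring

theorem vol₂_add_right {m : ℕ} (γ : ℤ → Fin m → ℝ) (n : ℤ) (p : ℕ) (u : Fin m → ℝ) {q : ℕ}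
    (hq : q < m) (w w' : Fin m → ℝ) :
    vol₂ γ n p u q (w + w') = vol₂ γ n p u q w + vol₂ γ n p u q w' :=
  vol_update_add _ hq _ _

theorem vol₂_smul_right {m : ℕ} (γ : ℤ → Fin m → ℝ) (n : ℤ) (p : ℕ) (u : Fin m → ℝ) {q : ℕ}
    (hq : q < m) (c : ℝ) (w : Fin m → ℝ) :
    vol₂ γ n p u q (c • w) = c * vol₂ γ n p u q w :=
  vol_update_smul _ hq _ _

theorem vol₂_add_left {m : ℕ} (γ : ℤ → Fin m → ℝ) (n : ℤ) {p q : ℕ} (hp : p < m) (hpq : p ≠ q)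
    (u u' w : Fin m → ℝ) :
    vol₂ γ n p (u + u') q w = vol₂ γ n p u q w + vol₂ γ n p u' q w := by
  simp only [vol₂, Function.update_comm hpq]
  exact vol_update_add _ hp _ _

theorem vol₂_smul_left {m : ℕ} (γ : ℤ → Fin m → ℝ) (n : ℤ) {p q : ℕ} (hp : p < m) (hpq : p ≠ q)
    (c : ℝ) (u w : Fin m → ℝ) :
    vol₂ γ n p (c • u) q w = c * vol₂ γ n p u q w := by
  simp only [vol₂, Function.update_comm hpq]
  exact vol_update_smul _ hp _ _

theorem omega₁_swap {m : ℕ} (N : ℕ) (γ X Y : ℤ → Fin m → ℝ) :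
    omega₁ N γ X Y = -omega₁ N γ Y X := by
  unfold omega₁
  rw [← mul_neg, ← Finset.sum_neg_distrib]
  congr 1
  refine Finset.sum_congr rfl fun n _ => ?_
  rw [← Finset.sum_neg_distrib]
  refine Finset.sum_congr rfl fun r _ => ?_
  ring

theorem omega₁_add_left {m : ℕ} (N : ℕ) (γ X X' Y : ℤ → Fin m → ℝ) :
    omega₁ N γ (fun k => X k + X' k) Y = omega₁ N γ X Y + omega₁ N γ X' Y := by
  simp only [omega₁, ← mul_add, ← Finset.sum_add_distrib]
  congr 1
  refine Finset.sum_congr rfl fun n _ => Finset.sum_congr rfl fun r hr => ?_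
  rw [Finset.mem_Icc] at hr
  rw [J_add, vol₂_add_right γ n 0 _ (by omega), vol₂_add_left γ n (by omega) (by omega),
    vol₂_add_left γ n (by omega) (by omega), vol₂_add_right γ n _ _ (by omega)]
  ring

theorem omega₁_smul_left {m : ℕ} (N : ℕ) (γ X Y : ℤ → Fin m → ℝ) (c : ℝ) :
    omega₁ N γ (fun k => c • X k) Y = c * omega₁ N γ X Y := by
  simp only [omega₁]
  rw [mul_left_comm c]
  congr 1
  rw [Finset.mul_sum]
  refine Finset.sum_congr rfl fun n _ => ?_
  rw [Finset.mul_sum]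
  refine Finset.sum_congr rfl fun r hr => ?_
  rw [Finset.mem_Icc] at hr
  rw [J_smul, vol₂_smul_right γ n 0 _ (by omega), vol₂_smul_left γ n (by omega) (by omega),
    vol₂_smul_left γ n (by omega) (by omega), vol₂_smul_right γ n _ _ (by omega)]
  ring

theorem contDiff_vol {E : Type*} [NormedAddCommGroup E] [NormedSpace ℝ E] {m : ℕ}
    {v : E → ℕ → Fin m → ℝ} (hv : ∀ j, ContDiff ℝ ∞ fun x => v x j) :
    ContDiff ℝ ∞ fun x => vol (v x) := by
  simp only [vol, Matrix.det_apply, Matrix.of_apply]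
  refine ContDiff.sum fun σ _ => ContDiff.const_smul _ (contDiff_prod fun i _ => ?_)
  exact contDiff_pi.1 (hv i) _

theorem contDiff_update {E : Type*} [NormedAddCommGroup E] [NormedSpace ℝ E] {m : ℕ}
    {v : E → ℕ → Fin m → ℝ} (hv : ∀ j, ContDiff ℝ ∞ fun x => v x j) (p : ℕ)
    {u : E → Fin m → ℝ} (hu : ContDiff ℝ ∞ u) (j : ℕ) :
    ContDiff ℝ ∞ fun x => Function.update (v x) p (u x) j := by
  by_cases h : j = p
  · subst h
    simpa using hu
  · simpa [h] using hv j

theorem contDiff_omega₁ {E : Type*} [NormedAddCommGroup E] [NormedSpace ℝ E] {m : ℕ} (N : ℕ)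
    {γ X Y : E → ℤ → Fin m → ℝ} (hγ : ∀ n, ContDiff ℝ ∞ fun x => γ x n)
    (hX : ∀ n, ContDiff ℝ ∞ fun x => X x n) (hY : ∀ n, ContDiff ℝ ∞ fun x => Y x n) :
    ContDiff ℝ ∞ fun x => omega₁ N (γ x) (X x) (Y x) := by
  have hJ : ∀ {Z : E → ℤ → Fin m → ℝ}, (∀ n, ContDiff ℝ ∞ fun x => Z x n) → ∀ n,
      ContDiff ℝ ∞ fun x => J (γ x) (Z x) n := by
    intro Z hZ n
    refine ContDiff.const_smul _ (ContDiff.sum fun l _ =>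
      (?_ : ContDiff ℝ ∞ fun x => invariant (γ x) n l).smul (hZ (n + l)))
    by_cases hl : l = 0
    · simpa [invariant, hl] using contDiff_const
    · simpa [invariant, hl] using contDiff_vol (contDiff_update (fun j => hγ _) l (hγ _))
  have h2 : ∀ {u w : E → Fin m → ℝ}, ContDiff ℝ ∞ u → ContDiff ℝ ∞ w → ∀ n p q,
      ContDiff ℝ ∞ fun x => vol₂ (γ x) n p (u x) q (w x) := fun hu hw n p q =>
    contDiff_vol (contDiff_update (contDiff_update (fun j => hγ _) p hu) q hw)
  refine contDiff_const.mul (ContDiff.sum fun n _ => ContDiff.sum fun r _ => ?_)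
  exact (((h2 (hJ hY n) (hX _) _ _ _).sub (h2 (hJ hX n) (hY _) _ _ _)).sub
    (h2 (hX _) (hY _) _ _ _)).add (h2 (hY _) (hX _) _ _ _)

theorem contDiff_polygon {m N : ℕ} [NeZero N] (T : SL(m, ℝ)) (n : ℤ) :
    ContDiff ℝ ∞ fun x : Vertices m N => polygon T x n := by
  have : (fun x : Vertices m N => polygon T x n) =
      ((Matrix.mulVecLin (T ^ (n / (N : ℤ))).1).toContinuousLinearMap ∘L
        ContinuousLinearMap.proj (residue N n) : Vertices m N →L[ℝ] Fin m → ℝ) := by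
    ext x
    simp [polygon]
  rw [this]
  exact ContinuousLinearMap.contDiff _

/-- The form `ω₁` in the coordinates `x = (γ_0, …, γ_{N-1})`, as a differential 2-form given by the
same (polynomial) formula at all points `x` and vectors `X`, `Y` of `(ℝᵐ)ᴺ`; the form on the space
of arc length parametrized polygons is its restriction. -/
def omega₁Form {m N : ℕ} [NeZero N] (T : SL(m, ℝ)) (x : Vertices m N) :
    Vertices m N [⋀^Fin 2]→L[ℝ] ℝ where
  toFun v := omega₁ N (polygon T x) (polygon T (v 0)) (polygon T (v 1))
  map_update_add' v i a b := by
    have hadd : ∀ a b : Vertices m N,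
        polygon T (a + b) = fun n => polygon T a n + polygon T b n :=
      fun a b => funext (polygon_add T a b)
    fin_cases i
    · simp [hadd, omega₁_add_left]
    · simp only [Fin.mk_one, Function.update_self, ne_eq, zero_ne_one, not_false_eq_true,
        Function.update_of_ne, hadd]
      rw [omega₁_swap, omega₁_add_left, omega₁_swap N _ _ (polygon T a),
        omega₁_swap N _ _ (polygon T b)]
      ring
  map_update_smul' v i c a := by
    have hsmul : ∀ a : Vertices m N, polygon T (c • a) = fun n => c • polygon T a n :=
      fun a => funext (polygon_smul T c a)
    fin_cases i
    · simp [hsmul, omega₁_smul_left]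
    · simp only [Fin.mk_one, Function.update_self, ne_eq, zero_ne_one, not_false_eq_true,
        Function.update_of_ne, hsmul, smul_eq_mul]
      rw [omega₁_swap, omega₁_smul_left, omega₁_swap N _ _ (polygon T a)]
      ring
  cont := by
    refine (contDiff_omega₁ (E := Fin 2 → Vertices m N) N (γ := fun _ => polygon T x)
      (X := fun v => polygon T (v 0)) (Y := fun v => polygon T (v 1))
      (fun _ => contDiff_const) (fun n => ?_) (fun n => ?_)).continuous
    · exact (contDiff_polygon T n).comp (contDiff_apply ℝ _ (0 : Fin 2))
    · exact (contDiff_polygon T n).comp (contDiff_apply ℝ _ (1 : Fin 2))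
  map_eq_zero_of_eq' v i j h hij := by
    have h01 : v 0 = v 1 := by
      fin_cases i <;> fin_cases j <;> simp_all
    have := omega₁_swap N (polygon T x) (polygon T (v 1)) (polygon T (v 1))
    simp only [h01]
    linarith

/-- The form is smooth, so its exterior derivative is a genuine one. -/
theorem contDiff_omega₁Form {m N : ℕ} [NeZero N] (T : SL(m, ℝ)) :
    ContDiff ℝ ∞ (omega₁Form T : Vertices m N → Vertices m N [⋀^Fin 2]→L[ℝ] ℝ) := by
  let A := Vertices m N [⋀^Fin 2]→L[ℝ] ℝ
  let b := Module.finBasis ℝ (Vertices m N)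
  let ev : A →ₗ[ℝ] ((Fin 2 → Fin (Module.finrank ℝ (Vertices m N))) → ℝ) :=
    { toFun := fun f k => f fun i => b (k i)
      map_add' := fun _ _ => rfl
      map_smul' := fun _ _ => rfl }
  have hinj : ev.ker = ⊥ := by
    rw [LinearMap.ker_eq_bot]
    intro f g hfg
    have : f.toAlternatingMap = g.toAlternatingMap :=
      b.ext_alternating fun k _ => congrFun hfg k
    ext v
    exact DFunLike.congr_fun this v
  obtain ⟨g, hg⟩ := ev.exists_leftInverse_of_injective hinj
  have hfac : (omega₁Form T : Vertices m N → A) = fun x => g (ev (omega₁Form T x)) := by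
    funext x
    exact (DFunLike.congr_fun hg (omega₁Form T x)).symm
  rw [hfac]
  refine (LinearMap.toContinuousLinearMap g).contDiff.comp (contDiff_pi.2 fun k => ?_)
  exact contDiff_omega₁ N (contDiff_polygon T) (fun _ => contDiff_const) (fun _ => contDiff_const)

/-- If `N` and `m` are coprime, the differentials of `d_0, …, d_{N-1}` are linearly independent at
each point of the level set, which is therefore a smooth submanifold with tangent space
`tangent T x`. -/
theorem surjective_fderiv_arcLength {m N : ℕ} [NeZero N] (hm : 2 ≤ m) (hNm : Nat.Coprime N m)
    (T : SL(m, ℝ)) (x : Vertices m N) (hx : polygon T x ∈ arcLengthPolygons N T) :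
    Function.Surjective fun (X : Vertices m N) (n : Fin N) =>
      fderiv ℝ (fun y : Vertices m N => arcLength (polygon T y) (n : ℕ)) x X := by
  have hN : (0 : ℤ) < N := by exact_mod_cast NeZero.pos N
  -- the derivative along `X_i = s_i x_i`
  have hder : ∀ (s : Fin N → ℝ) (n : ℤ),
      fderiv ℝ (fun y : Vertices m N => arcLength (polygon T y) n) x (fun i => s i • x i) =
        ∑ j : Fin m, s (residue N (n + (j : ℕ))) := by
    intro s n
    have hd : DifferentiableAt ℝ (fun y : Vertices m N => arcLength (polygon T y) n) x :=
      (contDiff_vol (fun j => contDiff_polygon T _)).differentiable (by simp) x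
    rw [← hd.lineDeriv_eq_fderiv, lineDeriv]
    have e : (fun t : ℝ => arcLength (polygon T (x + t • fun i => s i • x i)) n) =
        fun t => ∏ j : Fin m, (1 + t * s (residue N (n + (j : ℕ)))) := by
      funext t
      have hu : ∀ k, polygon T (x + t • fun i => s i • x i) k =
          (1 + t * s (residue N k)) • polygon T x k := by
        intro k
        simp [polygon, Matrix.mulVec_add, Matrix.mulVec_smul, add_smul, mul_smul]
      have h1 := hx.2 n
      simp only [arcLength, vol, hu] at h1 ⊢
      have := Matrix.det_mul_row (fun j : Fin m => 1 + t * s (residue N (n + (j : ℕ))))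
        (Matrix.of fun i j : Fin m => polygon T x (n + (j : ℕ)) i)
      rw [h1, mul_one] at this
      simpa using this
    rw [e]
    have hp : HasDerivAt (fun t : ℝ => ∏ j : Fin m, (1 + t * s (residue N (n + (j : ℕ)))))
        (∑ j : Fin m, (∏ i ∈ Finset.univ.erase j, (1 + (0 : ℝ) * s (residue N (n + (i : ℕ))))) •
          s (residue N (n + (j : ℕ)))) 0 :=
      HasDerivAt.fun_finsetProd fun j _ => by
        simpa using ((hasDerivAt_id (0 : ℝ)).mul_const (s (residue N (n + (j : ℕ))))).const_add 1
    rw [hp.deriv]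
    simp
  let R : (Fin N → ℝ) →ₗ[ℝ] (Fin N → ℝ) :=
    { toFun := fun s n => ∑ j : Fin m, s (residue N (((n : ℕ) : ℤ) + (j : ℕ)))
      map_add' := fun s t => by ext n; simp [Finset.sum_add_distrib]
      map_smul' := fun c s => by ext n; simp [Finset.mul_sum] }
  have hRinj : Function.Injective R := by
    rw [injective_iff_map_eq_zero]
    intro s hs
    let f : ℤ → ℝ := fun n => s (residue N n)
    have hper : ∀ n, f (n + N) = f n := by
      intro n
      simp [f, residue]
    have hperk : Function.Periodic f (N : ℤ) := hper
    have hres : ∀ n : ℤ, ((residue N n : ℕ) : ℤ) = n % N := fun n =>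
      Int.toNat_of_nonneg (Int.emod_nonneg n hN.ne')
    have hsum : ∀ n : ℤ, ∑ j ∈ Finset.range m, f (n + (j : ℕ)) = 0 := by
      intro n
      have := congrFun hs (residue N n)
      simp only [R, LinearMap.coe_mk, AddHom.coe_mk, hres] at this
      rw [Finset.sum_range]
      rw [Pi.zero_apply] at this
      rw [← this]
      refine Finset.sum_congr rfl fun j _ => ?_
      simp [f, residue]
    have hperm : Function.Periodic f (m : ℤ) := by
      intro n
      have h1 := hsum n
      have h2 := hsum (n + 1)
      obtain ⟨k, rfl⟩ : ∃ k, m = k + 1 := ⟨m - 1, by omega⟩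
      rw [Finset.sum_range_succ'] at h1
      rw [Finset.sum_range_succ] at h2
      have e1 : ∀ j : ℕ, n + 1 + (j : ℤ) = n + ((j + 1 : ℕ) : ℤ) := fun j => by push_cast; ring
      simp only [e1] at h2
      simp only [Nat.cast_zero, add_zero] at h1
      linarith
    have hone : Function.Periodic f 1 := by
      have hb : (1 : ℤ) = Nat.gcdA N m * N + Nat.gcdB N m * m := by
        have := Nat.gcd_eq_gcd_ab N m
        rw [hNm] at this
        push_cast at this
        linarith
      rw [hb]
      exact (hperk.int_mul _).add_period (hperm.int_mul _)
    have hconst : ∀ n, f n = f 0 := by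
      intro n
      simpa using (hone.int_mul n) 0
    have h0 : f 0 = 0 := by
      have := hsum 0
      simp only [hconst] at this
      simp only [Finset.sum_const, Finset.card_range, nsmul_eq_mul, mul_eq_zero,
        Nat.cast_eq_zero] at this
      rcases this with h | h
      · omega
      · exact h
    funext i
    have hi : residue N ((i : ℕ) : ℤ) = i := by
      apply Fin.ext
      have : (((i : ℕ) : ℤ)) % N = (i : ℕ) :=
        Int.emod_eq_of_lt (by positivity) (by exact_mod_cast i.2)
      simp [residue, this]
    have := hconst ((i : ℕ) : ℤ)
    simp only [f, hi] at this
    rw [this]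
    exact h0
  intro y
  obtain ⟨s, hs⟩ := (LinearMap.injective_iff_surjective.1 hRinj) y
  refine ⟨fun i => s i • x i, ?_⟩
  funext n
  rw [← hs]
  exact hder s _

end CentroAffine

end

/-! Since d_n = 1, each frame γ_n, …, γ_{n+m-1} is a basis, and a sequence X is encoded by the
matrices M_n(X) (`motion`) carrying γ_{n+j} to X_{n+j} for 0 ≤ j < m. Tangency gives tr M_n(X) = 0.
With D_n(X) (`defect`) measuring how far X fails the recurrence of γ, and c_n = |γ_{n+1}, …,
γ_{n+m-1}, ·| (`lastCoord`), consecutive matrices differ by one of rank at most one: M_{n+1}(X) =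
M_n(X) + D_n(X) ⊗ c_n (`motion_succ`).

Up to a telescoping sum, ω₁ pairs each sequence with the defect of the other
(`omega₁_eq_sum_mixedSum`). For tangent X, Y this reads ½ ∑ (c_n(M_{n+1}(X) D_n(Y)) - c_n(M_{n+1}(Y)
D_n(X))).

Closedness: extend Y, Z as constant fields and differentiate along X. Varying the frame columns
gives a double sum symmetric in the direction of differentiation and one argument, which cancels in
dω₁. Varying the defect gives traces tr(M_{n+1}(Y) M_n(Z) (D_n(X) ⊗ c_n)), because the derivative of
D_n(Z) is -M_n(Z) D_n(X). Tangency forces c_n(D_n(X)) = 0, so products of two rank-one corrections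
vanish, and the alternating sum of these traces is exactly the increment from n to n+1 of tr(M(X)
M(Z) M(Y)) - tr(M(X) M(Y) M(Z)) (`omegaDerivSummand_alternating_sum`). Shifting n by N conjugates
M_n by T, so this quantity is periodic and its increments sum to zero over a period.

Kernel: take X_n = A γ_n with A ≠ 0 traceless and commuting with T. Its defect vanishes and its
motion is constantly A, so the summand of 2ω₁(X, Y) is the increment of tr(A M_n(Y)), which is again
periodic. -/

noncomputable section

namespace CentroAffine

/-! ### Determinants of lists of vectors -/

/-- The matrix whose columns are the first `m` vectors of a list. -/
def cols {m : ℕ} (v : ℕ → Fin m → ℝ) : Matrix (Fin m) (Fin m) ℝ :=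
  Matrix.of fun i j => v j i

theorem vol_eq_det {m : ℕ} (v : ℕ → Fin m → ℝ) : vol v = (cols v).det := rfl

theorem cols_update {m : ℕ} (v : ℕ → Fin m → ℝ) {p : ℕ} (hp : p < m) (c : Fin m → ℝ) :
    cols (Function.update v p c) = (cols v).updateCol ⟨p, hp⟩ c := by
  ext i j
  by_cases h : (j : ℕ) = p
  · have : j = ⟨p, hp⟩ := Fin.ext h
    subst this
    simp [cols]
  · have : j ≠ ⟨p, hp⟩ := fun h' => h (congrArg Fin.val h')
    simp [cols, h, this]

/-- Cramer's rule: as a function of one column the determinant is a coordinate of a linear map. The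
linearity facts below and the covector representing `lastCoord` are read off from it. -/
theorem vol_update_eq_adjugate {m : ℕ} (v : ℕ → Fin m → ℝ) {p : ℕ} (hp : p < m)
    (c : Fin m → ℝ) :
    vol (Function.update v p c) = ((cols v).adjugate *ᵥ c) ⟨p, hp⟩ := by
  rw [vol_eq_det, cols_update v hp, ← Matrix.cramer_eq_adjugate_mulVec, Matrix.cramer_apply]

theorem vol_update_zero {m : ℕ} (v : ℕ → Fin m → ℝ) {p : ℕ} (hp : p < m) :
    vol (Function.update v p 0) = 0 := by
  simp [vol_update_eq_adjugate v hp]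

theorem vol_update_sub {m : ℕ} (v : ℕ → Fin m → ℝ) {p : ℕ} (hp : p < m) (a b : Fin m → ℝ) :
    vol (Function.update v p (a - b)) =
      vol (Function.update v p a) - vol (Function.update v p b) := by
  simp [vol_update_eq_adjugate v hp, Matrix.mulVec_sub]

theorem vol_update_neg {m : ℕ} (v : ℕ → Fin m → ℝ) {p : ℕ} (hp : p < m) (a : Fin m → ℝ) :
    vol (Function.update v p (-a)) = -vol (Function.update v p a) := by
  simp [vol_update_eq_adjugate v hp, Matrix.mulVec_neg]

theorem vol_update_eq_zero {m : ℕ} (v : ℕ → Fin m → ℝ) {p q : ℕ} (hp : p < m) (hq : q < m)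
    (hpq : p ≠ q) : vol (Function.update v p (v q)) = 0 := by
  rw [vol_eq_det]
  refine Matrix.det_zero_of_column_eq (i := ⟨p, hp⟩) (j := ⟨q, hq⟩) (by simpa using hpq) ?_
  intro k
  simp [cols, hpq.symm]

/-- Moving the first vector to the last position. -/
theorem vol_rotate {m : ℕ} (hm : 0 < m) {v w : ℕ → Fin m → ℝ}
    (h : ∀ j, j + 1 < m → w j = v (j + 1)) (h0 : w (m - 1) = v 0) :
    vol w = (-1) ^ (m - 1) * vol v := by
  obtain ⟨k, rfl⟩ : ∃ k, m = k + 1 := ⟨m - 1, by omega⟩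
  have e : cols w = (cols v).submatrix id (finRotate (k + 1)) := by
    ext i j
    simp only [cols, Matrix.of_apply, Matrix.submatrix_apply, id]
    by_cases hj : (j : ℕ) = k
    · have : j = Fin.last k := Fin.ext hj
      subst this
      simpa using congrFun h0 i
    · have hj' : (j : ℕ) < k := by omega
      rw [coe_finRotate_of_ne_last (fun h => hj (by simp [h])), h j (by omega)]
  rw [vol_eq_det, vol_eq_det, e, Matrix.det_permute', sign_finRotate]
  simp

/-- A linear map acts on the determinant, as a derivation, by its trace. -/
theorem sum_vol_update_mulVec {m : ℕ} (v : ℕ → Fin m → ℝ) (A : Matrix (Fin m) (Fin m) ℝ) :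
    ∑ j ∈ Finset.range m, vol (Function.update v j (A *ᵥ v j)) = A.trace * vol v := by
  rw [Finset.sum_range]
  have e : ∀ j : Fin m, vol (Function.update v j (A *ᵥ v j)) =
      ((cols v).adjugate * (A * cols v)) j j := by
    intro j
    rw [vol_update_eq_adjugate v j.2, Matrix.mul_apply]
    rfl
  simp only [e]
  change Matrix.trace _ = _
  rw [Matrix.trace_mul_comm, Matrix.mul_assoc, Matrix.mul_adjugate, vol_eq_det]
  simp [mul_comm]

/-- With zero trace the derivation kills the determinant, so its action on the first m - 1 columns
is minus its action on the last one. -/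
theorem sum_vol_update_mulVec_of_trace_eq_zero {m : ℕ} (hm : 0 < m) (v : ℕ → Fin m → ℝ)
    {A : Matrix (Fin m) (Fin m) ℝ} (hA : A.trace = 0) :
    ∑ j ∈ Finset.range (m - 1), vol (Function.update v j (A *ᵥ v j)) =
      -vol (Function.update v (m - 1) (A *ᵥ v (m - 1))) := by
  have h := sum_vol_update_mulVec v A
  obtain ⟨k, rfl⟩ : ∃ k, m = k + 1 := ⟨m - 1, by omega⟩
  rw [Finset.sum_range_succ, hA, zero_mul] at h
  simp only [Nat.add_sub_cancel]
  linarith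

theorem vol_mulVec {m : ℕ} (A : Matrix (Fin m) (Fin m) ℝ) (v : ℕ → Fin m → ℝ) :
    vol (fun j => A *ᵥ v j) = A.det * vol v := by
  rw [vol_eq_det, vol_eq_det, ← Matrix.det_mul]
  rfl

/-- The product rule for a continuous multilinear map; the transpose turns columns into the rows in
which `Matrix.detRowAlternating` is multilinear. -/
theorem hasDerivAt_vol {m : ℕ} {v : ℝ → ℕ → Fin m → ℝ} {v' : ℕ → Fin m → ℝ} {t : ℝ}
    (h : ∀ j < m, HasDerivAt (fun s => v s j) (v' j) t) :
    HasDerivAt (fun s => vol (v s)) (∑ j ∈ Finset.range m, vol (Function.update (v t) j (v' j)))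
      t := by
  have e : ∀ w : ℕ → Fin m → ℝ, vol w = Matrix.detRowAlternating (fun j : Fin m => w j) := by
    intro w
    rw [vol_eq_det, ← Matrix.det_transpose]
    rfl
  let D : ContinuousMultilinearMap ℝ (fun _ : Fin m => Fin m → ℝ) ℝ :=
    { (Matrix.detRowAlternating (n := Fin m) (R := ℝ)).toMultilinearMap with
      cont := by
        change Continuous fun M : Matrix (Fin m) (Fin m) ℝ => M.det
        exact continuous_id.matrix_det }
  have hD : ∀ w, vol w = D (fun j : Fin m => w j) := e
  have h1 : HasDerivAt (fun s => fun j : Fin m => v s j) (fun j : Fin m => v' j) t :=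
    hasDerivAt_pi.2 fun j => h j j.2
  have h2 := (D.hasFDerivAt (fun j : Fin m => v t j)).comp_hasDerivAt t h1
  have hs : ∑ j ∈ Finset.range m, vol (Function.update (v t) j (v' j)) =
      D.linearDeriv (fun j : Fin m => v t j) fun j : Fin m => v' j := by
    rw [Finset.sum_range, ContinuousMultilinearMap.linearDeriv_apply]
    refine Finset.sum_congr rfl fun j _ => ?_
    rw [hD]
    congr 1
    funext i
    by_cases hij : i = j
    · subst hij; simp
    · have : (i : ℕ) ≠ j := fun h' => hij (Fin.ext h')
      simp [hij, this]
  rw [hs]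
  simp only [hD]
  exact h2

/-! ### A compact expression of `ω₁` -/

/-- The failure `X_{n+m} - ∑_l a_n^l X_{n+l}` of `X` to satisfy the recurrence of `γ`. -/
def defect {m : ℕ} (γ X : ℤ → Fin m → ℝ) (n : ℤ) : Fin m → ℝ :=
  X (n + m) - ∑ l ∈ Finset.range m, invariant γ n l • X (n + l)

/-- The sum over `1 ≤ r ≤ m - 1` of the determinants `|γ_{n+1}, …, X_{n+r}, …, γ_{n+m-1}, u|`. -/
def mixedSum {m : ℕ} (γ X : ℤ → Fin m → ℝ) (u : Fin m → ℝ) (n : ℤ) : ℝ :=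
  ∑ r ∈ Finset.range (m - 1), vol (Function.update
    (Function.update (fun j => γ (n + 1 + j)) r (X (n + 1 + r))) (m - 1) u)

theorem mixedSum_neg {m : ℕ} (hm : 0 < m) (γ X : ℤ → Fin m → ℝ) (u : Fin m → ℝ) (n : ℤ) :
    mixedSum γ X (-u) n = -mixedSum γ X u n := by
  simp only [mixedSum, ← Finset.sum_neg_distrib]
  exact Finset.sum_congr rfl fun r _ => vol_update_neg _ (by omega) _

theorem sum_Icc_telescope (f : ℤ → ℝ) (N : ℕ) :
    ∑ n ∈ Finset.Icc (1 : ℤ) N, (f (n + 1) - f n) = f (N + 1) - f 1 := by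
  induction N with
  | zero => simp
  | succ k ih =>
    have e : Finset.Icc (1 : ℤ) ((k + 1 : ℕ) : ℤ) =
        insert ((k : ℤ) + 1) (Finset.Icc (1 : ℤ) k) := by
      ext x
      simp only [Finset.mem_Icc, Finset.mem_insert]
      push_cast
      omega
    rw [e, Finset.sum_insert (by simp), ih]
    push_cast
    ring

theorem sum_Icc_telescope_of_periodic {f : ℤ → ℝ} {N : ℕ} (hf : ∀ n, f (n + N) = f n) :
    ∑ n ∈ Finset.Icc (1 : ℤ) N, (f (n + 1) - f n) = 0 := by
  rw [sum_Icc_telescope, add_comm (N : ℤ) 1, hf, sub_self]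

theorem sum_Icc_one_eq_sum_range (f : ℕ → ℝ) (k : ℕ) :
    ∑ r ∈ Finset.Icc 1 k, f r = ∑ r ∈ Finset.range k, f (r + 1) := by
  refine Finset.sum_nbij' (· - 1) (· + 1) ?_ ?_ ?_ ?_ ?_ <;>
    simp only [Finset.mem_Icc, Finset.mem_range] <;> intro a ha
  · omega
  · omega
  · omega
  · omega
  · rw [Nat.sub_add_cancel ha.1]

/-- The sign in `J` is the signature of the cyclic permutation moving the first column to the end,
so the two cancel and leave the bare recurrence sum in the last column. -/
theorem vol₂_zero_J {m : ℕ} (γ Y : ℤ → Fin m → ℝ) (n : ℤ) {r : ℕ} (hr : r + 1 < m)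
    (w : Fin m → ℝ) :
    vol₂ γ n 0 (J γ Y n) (r + 1) w = vol (Function.update
      (Function.update (fun j => γ (n + 1 + j)) r w) (m - 1)
        (∑ l ∈ Finset.range m, invariant γ n l • Y (n + l))) := by
  have h := vol_rotate (m := m) (by omega)
    (v := Function.update (Function.update (fun j => γ (n + j)) 0 (J γ Y n)) (r + 1) w)
    (w := Function.update (Function.update (fun j => γ (n + 1 + j)) r w) (m - 1) (J γ Y n)) ?_ ?_
  · rw [J, vol_update_smul _ (by omega)] at h
    have hs : ((-1 : ℝ) ^ (m - 1)) ≠ 0 := pow_ne_zero _ (by norm_num)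
    exact (mul_left_cancel₀ hs h).symm
  · intro j hj
    rw [Function.update_of_ne (by omega)]
    by_cases h : j = r
    · subst h; simp
    · rw [Function.update_of_ne h, Function.update_of_ne (by omega),
        Function.update_of_ne (by omega)]
      push_cast
      congr 1
      ring
  · simp

/-- Shifting by a period multiplies every column by T, and det T = 1. -/
theorem IsTwisted.vol₂_add_period {m N : ℕ} {T : SL(m, ℝ)} {γ : ℤ → Fin m → ℝ}
    (h : IsTwisted N T γ) (n : ℤ) (p q : ℕ) (u w : Fin m → ℝ) :
    vol₂ γ (n + N) p (T.1 *ᵥ u) q (T.1 *ᵥ w) = vol₂ γ n p u q w := by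
  have e := vol_mulVec T.1 (Function.update (Function.update (fun j : ℕ => γ (n + j)) p u) q w)
  rw [T.2, one_mul] at e
  rw [vol₂, vol₂, ← e]
  congr 1
  funext j
  by_cases hq : j = q
  · subst hq; simp
  · by_cases hp : j = p
    · subst hp; simp [hq]
    · simp only [Function.update_of_ne hq, Function.update_of_ne hp]
      rw [← h (n + j)]
      congr 1
      ring

/-- Shifted from n to n + 1, the last two determinants of ω₁ have Y_{n+m} or X_{n+m} in the last
column, and join the `J` terms to form the defects; the shift costs nothing over a period. Only
twistedness is needed, so the identity also holds along lines γ + tX that leave the level set and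
may be differentiated there. -/
theorem omega₁_eq_sum_mixedSum {m N : ℕ} {T : SL(m, ℝ)} {γ X Y : ℤ → Fin m → ℝ}
    (hγ : IsTwisted N T γ) (hX : IsTwisted N T X) (hY : IsTwisted N T Y) :
    omega₁ N γ X Y = (1 / 2) * ∑ n ∈ Finset.Icc (1 : ℤ) N,
      (mixedSum γ Y (defect γ X n) n - mixedSum γ X (defect γ Y n) n) := by
  let g : (ℤ → Fin m → ℝ) → (ℤ → Fin m → ℝ) → ℤ → ℕ → ℝ := fun X Y n r =>
    vol₂ γ n r (X (n + r)) (m - 1) (Y (n + m - 1))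
  have hg : ∀ {X Y : ℤ → Fin m → ℝ}, IsTwisted N T X → IsTwisted N T Y → ∀ n r,
      g X Y (n + N) r = g X Y n r := by
    intro X Y hX hY n r
    have e1 : n + N + (r : ℤ) = (n + r) + N := by ring
    have e2 : n + N + (m : ℤ) - 1 = (n + m - 1) + N := by ring
    simp only [g, e1, e2, hX _, hY _, hγ.vol₂_add_period]
  have hQ : ∀ (X Y : ℤ → Fin m → ℝ) n, mixedSum γ X (defect γ Y n) n =
      ∑ r ∈ Finset.range (m - 1), (g X Y (n + 1) r -
        vol₂ γ n 0 (J γ Y n) (r + 1) (X (n + (r + 1 : ℕ)))) := by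
    intro X Y n
    refine Finset.sum_congr rfl fun r hr => ?_
    rw [Finset.mem_range] at hr
    rw [vol₂_zero_J γ Y n (by omega), defect, vol_update_sub _ (by omega)]
    have e1 : n + ((r + 1 : ℕ) : ℤ) = n + 1 + r := by push_cast; ring
    have e2 : n + 1 + (m : ℤ) - 1 = n + m := by ring
    simp only [g, vol₂, e1, e2]
  -- The total of the increments that account for replacing n by n + 1 in the last two determinants.
  have ht := sum_Icc_telescope_of_periodic (N := N)
    (f := fun n => ∑ r ∈ Finset.range (m - 1), (g X Y n r - g Y X n r))
    (fun n => by simp only [hg hX hY, hg hY hX])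
  rw [omega₁, ← sub_eq_zero, ← mul_sub, ← Finset.sum_sub_distrib, ← mul_zero (1 / 2 : ℝ), ← ht]
  congr 1
  refine Finset.sum_congr rfl fun n _ => ?_
  rw [sum_Icc_one_eq_sum_range, hQ, hQ, ← Finset.sum_sub_distrib, ← Finset.sum_sub_distrib,
    ← Finset.sum_sub_distrib]
  refine Finset.sum_congr rfl fun r _ => ?_
  have e1 : n + ((r + 1 : ℕ) : ℤ) - 1 = n + r := by push_cast; ring
  simp only [g, e1, Nat.add_sub_cancel]
  ring

/-! ### The recurrence and the infinitesimal motions of the frames -/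

/-- Cramer's rule before normalising d_n = 1: rotating the columns identifies the coefficient of γ_n
as a multiple of d_{n+1}. Being valid for every γ, it can be differentiated in any direction. -/
theorem arcLength_smul_eq {m : ℕ} (hm : 2 ≤ m) (γ : ℤ → Fin m → ℝ) (n : ℤ) :
    arcLength γ n • γ (n + m) = ((-1) ^ (m - 1) * arcLength γ (n + 1)) • γ n +
      ∑ l ∈ Finset.range (m - 1), invariant γ n (l + 1) • γ (n + (l + 1 : ℕ)) := by
  have h := Matrix.mulVec_cramer (cols fun j => γ (n + j)) (γ (n + m))
  have hc : ∀ l : Fin m, Matrix.cramer (cols fun j => γ (n + j)) (γ (n + m)) l =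
      vol (Function.update (fun j : ℕ => γ (n + j)) l (γ (n + m))) := by
    intro l
    rw [vol_eq_det, cols_update _ l.2, Matrix.cramer_apply]
  have hsum : cols (fun j => γ (n + j)) *ᵥ Matrix.cramer (cols fun j => γ (n + j)) (γ (n + m)) =
      ∑ l ∈ Finset.range m,
        vol (Function.update (fun j : ℕ => γ (n + j)) l (γ (n + m))) • γ (n + l) := by
    rw [Finset.sum_range]
    ext i
    simp only [Matrix.mulVec, dotProduct, hc]
    simp [cols, mul_comm]
  rw [hsum] at h
  have h0 : vol (Function.update (fun j : ℕ => γ (n + j)) 0 (γ (n + m))) =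
      (-1) ^ (m - 1) * arcLength γ (n + 1) := by
    have hr := vol_rotate (m := m) (by omega) (w := fun j : ℕ => γ (n + 1 + j))
      (v := Function.update (fun j : ℕ => γ (n + j)) 0 (γ (n + m))) ?_ ?_
    · rw [arcLength, hr, ← mul_assoc, ← mul_pow]
      simp
    · intro j _
      rw [Function.update_of_ne (by omega)]
      push_cast
      congr 1
      ring
    · rw [Function.update_self]
      congr 1
      have : ((m - 1 : ℕ) : ℤ) = m - 1 := by omega
      rw [this]
      ring
  obtain ⟨k, rfl⟩ : ∃ k, m = k + 1 := ⟨m - 1, by omega⟩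
  rw [Finset.sum_range_succ', h0] at h
  change (cols fun j => γ (n + j)).det • _ = _
  refine h.symm.trans ((add_comm _ _).trans ?_)
  simp [invariant]

/-- Isolates the coefficient a_n^0, which is constant and so contributes nothing when γ varies. -/
theorem defect_eq {m : ℕ} (hm : 0 < m) (γ X : ℤ → Fin m → ℝ) (n : ℤ) :
    defect γ X n = X (n + m) - (-1 : ℝ) ^ (m - 1) • X n -
      ∑ l ∈ Finset.range (m - 1), invariant γ n (l + 1) • X (n + (l + 1 : ℕ)) := by
  obtain ⟨k, rfl⟩ : ∃ k, m = k + 1 := ⟨m - 1, by omega⟩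
  rw [defect, Finset.sum_range_succ']
  simp only [invariant, Nat.add_sub_cancel, if_true, Nat.cast_zero, add_zero]
  abel

theorem defect_self {m : ℕ} (hm : 2 ≤ m) {γ : ℤ → Fin m → ℝ} (h : ∀ n, arcLength γ n = 1)
    (n : ℤ) : defect γ γ n = 0 := by
  have := arcLength_smul_eq hm γ n
  rw [h, h, one_smul, mul_one] at this
  rw [defect_eq (by omega), this]
  abel

/-- The matrix taking `γ_{n+j}` to `X_{n+j}` for `0 ≤ j < m`. -/
def motion {m : ℕ} (γ X : ℤ → Fin m → ℝ) (n : ℤ) : Matrix (Fin m) (Fin m) ℝ :=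
  cols (fun j => X (n + j)) * (cols fun j => γ (n + j))⁻¹

/-- The linear form `u ↦ |γ_{n+1}, …, γ_{n+m-1}, u|`. -/
def lastCoord {m : ℕ} (γ : ℤ → Fin m → ℝ) (n : ℤ) (u : Fin m → ℝ) : ℝ :=
  vol (Function.update (fun j : ℕ => γ (n + 1 + j)) (m - 1) u)

theorem exists_lastCoord_eq_dotProduct {m : ℕ} (hm : 0 < m) (γ : ℤ → Fin m → ℝ) (n : ℤ) :
    ∃ c : Fin m → ℝ, ∀ u, lastCoord γ n u = c ⬝ᵥ u :=
  ⟨(cols fun j => γ (n + 1 + j)).adjugate ⟨m - 1, by omega⟩, fun u =>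
    vol_update_eq_adjugate _ (by omega) u⟩

theorem lastCoord_vertex {m : ℕ} (γ : ℤ → Fin m → ℝ) (n : ℤ) {j : ℕ} (hj : j + 1 < m) :
    lastCoord γ n (γ (n + 1 + j)) = 0 :=
  vol_update_eq_zero (fun j : ℕ => γ (n + 1 + j)) (p := m - 1) (q := j) (by omega) (by omega)
    (by omega)

theorem isUnit_det_frame {m : ℕ} {γ : ℤ → Fin m → ℝ} (h : ∀ n, arcLength γ n = 1) (n : ℤ) :
    IsUnit (cols fun j => γ (n + j)).det := by
  change IsUnit (arcLength γ n)
  simp [h]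

theorem matrix_ext_of_frame {m : ℕ} {γ : ℤ → Fin m → ℝ} (h : ∀ n, arcLength γ n = 1) (n : ℤ)
    {A B : Matrix (Fin m) (Fin m) ℝ} (hAB : ∀ j < m, A *ᵥ γ (n + j) = B *ᵥ γ (n + j)) : A = B := by
  have e : A * cols (fun j => γ (n + j)) = B * cols (fun j => γ (n + j)) := by
    ext i j
    exact congrFun (hAB j j.2) i
  have hu := isUnit_det_frame h n
  calc A = A * cols (fun j => γ (n + j)) * (cols fun j => γ (n + j))⁻¹ := by
        rw [Matrix.mul_assoc, Matrix.mul_nonsing_inv _ hu, Matrix.mul_one]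
    _ = B := by rw [e, Matrix.mul_assoc, Matrix.mul_nonsing_inv _ hu, Matrix.mul_one]

section Motion

variable {m N : ℕ} {T : SL(m, ℝ)} {γ X Y Z : ℤ → Fin m → ℝ}

theorem motion_mulVec (h : ∀ n, arcLength γ n = 1) (X : ℤ → Fin m → ℝ) (n : ℤ) {j : ℕ}
    (hj : j < m) : motion γ X n *ᵥ γ (n + j) = X (n + j) := by
  have e : motion γ X n * cols (fun j => γ (n + j)) = cols fun j => X (n + j) := by
    rw [motion, Matrix.mul_assoc, Matrix.nonsing_inv_mul _ (isUnit_det_frame h n), Matrix.mul_one]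
  ext i
  exact congrFun (congrFun e i) ⟨j, hj⟩

theorem motion_add_period (h : ∀ n, arcLength γ n = 1) (hγ : IsTwisted N T γ)
    (hX : IsTwisted N T X) (n : ℤ) : motion γ X (n + N) * T.1 = T.1 * motion γ X n := by
  refine matrix_ext_of_frame h n fun j hj => ?_
  rw [← Matrix.mulVec_mulVec, ← Matrix.mulVec_mulVec, motion_mulVec h X n hj, ← hγ, ← hX]
  have e : n + (j : ℤ) + N = n + N + j := by ring
  rw [e, motion_mulVec h X _ hj]

/-- The monodromy acts on motions by conjugation, so traces of their products are periodic. -/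
theorem motion_add_period_eq (h : ∀ n, arcLength γ n = 1) (hγ : IsTwisted N T γ)
    (hX : IsTwisted N T X) (n : ℤ) :
    motion γ X (n + N) = T.1 * motion γ X n * (T⁻¹).1 := by
  rw [← motion_add_period h hγ hX, Matrix.mul_assoc, ← Matrix.SpecialLinearGroup.coe_mul]
  simp

theorem trace_motion (h : ∀ n, arcLength γ n = 1) (X : ℤ → Fin m → ℝ) (n : ℤ) :
    (motion γ X n).trace =
      ∑ j ∈ Finset.range m, vol (Function.update (fun j : ℕ => γ (n + j)) j (X (n + j))) := by
  have e := sum_vol_update_mulVec (fun j : ℕ => γ (n + j)) (motion γ X n)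
  change _ = _ * arcLength γ n at e
  rw [h, mul_one] at e
  rw [← e]
  refine Finset.sum_congr rfl fun j hj => ?_
  rw [motion_mulVec h X n (Finset.mem_range.1 hj)]

/-- Apply the motion to the recurrence of γ: it yields the recurrence sum for X, which misses
X_{n+m} by the defect. -/
theorem motion_mulVec_next (hm : 2 ≤ m) (h : ∀ n, arcLength γ n = 1) (X : ℤ → Fin m → ℝ) (n : ℤ) :
    motion γ X n *ᵥ γ (n + m) = X (n + m) - defect γ X n := by
  have e := defect_self hm h n
  rw [defect, sub_eq_zero] at e
  rw [e, Matrix.mulVec_sum, defect, sub_sub_cancel]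
  refine Finset.sum_congr rfl fun l hl => ?_
  rw [Matrix.mulVec_smul, motion_mulVec h X n (Finset.mem_range.1 hl)]

theorem lastCoord_next (hm : 0 < m) (h : ∀ n, arcLength γ n = 1) (n : ℤ) :
    lastCoord γ n (γ (n + m)) = 1 := by
  rw [← h (n + 1), lastCoord, arcLength]
  congr 1
  have e : n + (m : ℤ) = n + 1 + (m - 1 : ℕ) := by omega
  rw [e]
  exact Function.update_eq_self (m - 1) (fun j : ℕ => γ (n + 1 + j))

/-- The motion changes from one frame to the next by a matrix of rank at most one. -/
theorem motion_succ (hm : 2 ≤ m) (h : ∀ n, arcLength γ n = 1) (X : ℤ → Fin m → ℝ) (n : ℤ)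
    {c : Fin m → ℝ} (hc : ∀ u, lastCoord γ n u = c ⬝ᵥ u) :
    motion γ X (n + 1) = motion γ X n + Matrix.vecMulVec (defect γ X n) c := by
  refine matrix_ext_of_frame h (n + 1) fun j hj => ?_
  rw [motion_mulVec h X _ hj, Matrix.add_mulVec, Matrix.vecMulVec_mulVec, ← hc]
  by_cases hj' : j + 1 < m
  · have e : n + 1 + (j : ℤ) = n + (j + 1 : ℕ) := by push_cast; ring
    rw [lastCoord_vertex γ n hj', e, motion_mulVec h X n hj']
    simp
  · have e : n + 1 + (j : ℤ) = n + m := by omega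
    rw [e, lastCoord_next (by omega) h, motion_mulVec_next hm h]
    simp

theorem trace_mul_vecMulVec (A : Matrix (Fin m) (Fin m) ℝ) (u c : Fin m → ℝ) :
    (A * Matrix.vecMulVec u c).trace = c ⬝ᵥ (A *ᵥ u) := by
  rw [Matrix.mul_vecMulVec, Matrix.trace_vecMulVec, dotProduct_comm]

/-- A traceless matrix acts as a derivation on |γ_{n+1}, …, γ_{n+m-1}, u| with total zero; the mixed
sum collects all columns but the last. The relevant frame starts at n + 1, hence M_{n+1} in later
formulas. -/
theorem mixedSum_eq_neg_lastCoord (hm : 0 < m) (n : ℤ) {A : Matrix (Fin m) (Fin m) ℝ}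
    (hA : A.trace = 0) (hAX : ∀ j < m, A *ᵥ γ (n + 1 + j) = X (n + 1 + j)) (u : Fin m → ℝ) :
    mixedSum γ X u n = -lastCoord γ n (A *ᵥ u) := by
  have e := sum_vol_update_mulVec_of_trace_eq_zero hm
    (Function.update (fun j : ℕ => γ (n + 1 + j)) (m - 1) u) hA
  simp only [Function.update_self, Function.update_idem] at e
  rw [lastCoord, ← e, mixedSum]
  refine Finset.sum_congr rfl fun r hr => ?_
  rw [Finset.mem_range] at hr
  have hne : r ≠ m - 1 := by omega
  rw [Function.update_of_ne hne, hAX r (by omega), Function.update_comm hne]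

/-! ### The kernel of `ω₁` -/

theorem defect_mulVec (A : Matrix (Fin m) (Fin m) ℝ) (γ X : ℤ → Fin m → ℝ) (n : ℤ) :
    defect γ (fun k => A *ᵥ X k) n = A *ᵥ defect γ X n := by
  simp only [defect, Matrix.mulVec_sub, Matrix.mulVec_sum, Matrix.mulVec_smul]

/-- The infinitesimal centro-affine transformations that commute with the monodromy are in the
kernel of `ω₁`. -/
theorem omega₁_mulVec_eq_zero (hm : 2 ≤ m) (h : ∀ n, arcLength γ n = 1) (hγ : IsTwisted N T γ)
    (hY : IsTwisted N T Y) {A : Matrix (Fin m) (Fin m) ℝ} (hA : A.trace = 0)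
    (hAT : A * T.1 = T.1 * A) : omega₁ N γ (fun k => A *ᵥ γ k) Y = 0 := by
  have hX : IsTwisted N T fun k => A *ᵥ γ k := fun n => by
    simp only [hγ n, Matrix.mulVec_mulVec, hAT]
  rw [omega₁_eq_sum_mixedSum hγ hX hY]
  -- The summand is c_n(A D_n(Y)) = tr(A (M_{n+1}(Y) - M_n(Y))); periodicity of tr(A M_n(Y)) uses
  -- that A commutes with T.
  have ht := sum_Icc_telescope_of_periodic (N := N) (f := fun n => (A * motion γ Y n).trace) ?_
  · rw [← mul_zero (1 / 2 : ℝ), ← ht]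
    congr 1
    refine Finset.sum_congr rfl fun n _ => ?_
    obtain ⟨c, hc⟩ := exists_lastCoord_eq_dotProduct (by omega) γ n
    rw [mixedSum_eq_neg_lastCoord (X := fun k => A *ᵥ γ k) (by omega) n hA (fun _ _ => rfl),
      defect_mulVec,
      defect_self hm h, motion_succ hm h Y n hc, Matrix.mul_add, Matrix.trace_add,
      trace_mul_vecMulVec, hc, Matrix.mulVec_zero, add_sub_cancel_left, sub_neg_eq_add,
      add_eq_right, mixedSum]
    exact Finset.sum_eq_zero fun r _ => vol_update_zero _ (by omega)
  · intro n
    rw [motion_add_period_eq h hγ hY, ← Matrix.mul_assoc, ← Matrix.mul_assoc, hAT,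
      Matrix.trace_mul_comm, ← Matrix.mul_assoc, ← Matrix.mul_assoc,
      ← Matrix.SpecialLinearGroup.coe_mul]
    simp

/-- The traceless part of B works unless it vanishes; then B is scalar, commutes with everything,
and an off-diagonal matrix unit serves, which exists because m ≥ 2. -/
theorem exists_traceless_commute (hm : 2 ≤ m) (B : Matrix (Fin m) (Fin m) ℝ) :
    ∃ A : Matrix (Fin m) (Fin m) ℝ, A ≠ 0 ∧ A.trace = 0 ∧ A * B = B * A := by
  by_cases hB : B - (B.trace / m) • 1 = 0
  · have e : B = (B.trace / m) • (1 : Matrix (Fin m) (Fin m) ℝ) := sub_eq_zero.1 hB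
    have hne : (⟨0, by omega⟩ : Fin m) ≠ ⟨1, by omega⟩ := by simp
    refine ⟨Matrix.single ⟨0, by omega⟩ ⟨1, by omega⟩ 1, ?_, ?_, ?_⟩
    · intro h0
      have := congrFun (congrFun h0 ⟨0, by omega⟩) ⟨1, by omega⟩
      simp at this
    · exact Matrix.trace_single_eq_of_ne _ _ _ hne
    · rw [e]
      simp
  · refine ⟨_, hB, ?_, ?_⟩
    · have : (m : ℝ) ≠ 0 := by positivity
      simp [Matrix.trace_sub, Matrix.trace_smul, this]
    · simp [Matrix.sub_mul, Matrix.mul_sub]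

end Motion

/-! ### The derivative of `ω₁` along a tangent vector -/

/-- `X` preserves, infinitesimally, the arc lengths of `γ`. -/
def PreservesArcLength {m : ℕ} (γ X : ℤ → Fin m → ℝ) : Prop :=
  ∀ n, HasDerivAt (fun t : ℝ => arcLength (fun k => γ k + t • X k) n) 0 0

/-- The derivative of `a_n^r` at `γ` along `X`. -/
def invariantDeriv {m : ℕ} (γ X : ℤ → Fin m → ℝ) (n : ℤ) (r : ℕ) : ℝ :=
  deriv (fun t : ℝ => invariant (fun k => γ k + t • X k) n r) 0

section Derivative

variable {m N : ℕ} {T : SL(m, ℝ)} {γ X Y Z : ℤ → Fin m → ℝ}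

theorem hasDerivAt_add_smul (a b : Fin m → ℝ) (t : ℝ) :
    HasDerivAt (fun s : ℝ => a + s • b) b t := by
  simpa using ((hasDerivAt_id t).smul_const b).const_add a

theorem hasDerivAt_update {v : ℝ → ℕ → Fin m → ℝ} {v' : ℕ → Fin m → ℝ} {t : ℝ}
    (h : ∀ j, HasDerivAt (fun s => v s j) (v' j) t) (p : ℕ) {u : ℝ → Fin m → ℝ} {u' : Fin m → ℝ}
    (hu : HasDerivAt u u' t) (j : ℕ) :
    HasDerivAt (fun s => Function.update (v s) p (u s) j) (Function.update v' p u' j) t := by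
  by_cases hj : j = p
  · subst hj
    simpa using hu
  · simpa [hj] using h j

theorem hasDerivAt_invariant (γ X : ℤ → Fin m → ℝ) (n : ℤ) (r : ℕ) :
    HasDerivAt (fun t : ℝ => invariant (fun k => γ k + t • X k) n r) (invariantDeriv γ X n r)
      0 := by
  refine DifferentiableAt.hasDerivAt ?_
  by_cases hr : r = 0
  · simp [invariant, hr]
  · simp only [invariant, hr, if_false]
    exact (hasDerivAt_vol fun j _ => hasDerivAt_update (fun j => hasDerivAt_add_smul _ _ _) r
      (hasDerivAt_add_smul _ _ _) j).differentiableAt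

theorem PreservesArcLength.trace_motion_eq_zero (hX : PreservesArcLength γ X)
    (h : ∀ n, arcLength γ n = 1) (n : ℤ) : (motion γ X n).trace = 0 := by
  have h1 := hasDerivAt_vol (v := fun t j => γ (n + j) + t • X (n + j)) (t := 0)
    (v' := fun j => X (n + j)) fun j _ => hasDerivAt_add_smul _ _ _
  simp only [zero_smul, add_zero] at h1
  rw [trace_motion h]
  exact h1.unique (hX n)

/-- Differentiate the unnormalised recurrence along γ + tX. As d_n and d_{n+1} are stationary, no
multiple of γ_n appears: the defect lies in the span of γ_{n+1}, …, γ_{n+m-1}. -/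
theorem PreservesArcLength.defect_eq_sum (hm : 2 ≤ m) (hX : PreservesArcLength γ X)
    (h : ∀ n, arcLength γ n = 1) (n : ℤ) :
    defect γ X n =
      ∑ l ∈ Finset.range (m - 1), invariantDeriv γ X n (l + 1) • γ (n + (l + 1 : ℕ)) := by
  have hl := (hX n).smul (hasDerivAt_add_smul (γ (n + m)) (X (n + m)) 0)
  have hr := (((hX (n + 1)).const_mul ((-1) ^ (m - 1))).smul
    (hasDerivAt_add_smul (γ n) (X n) 0)).add
    (HasDerivAt.fun_sum (u := Finset.range (m - 1)) fun l _ =>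
      (hasDerivAt_invariant γ X n (l + 1)).smul
        (hasDerivAt_add_smul (γ (n + (l + 1 : ℕ))) (X (n + (l + 1 : ℕ))) 0))
  have e := hl.unique (hr.congr_of_eventuallyEq (Filter.Eventually.of_forall fun t =>
    arcLength_smul_eq hm (fun k => γ k + t • X k) n))
  simp only [zero_smul, add_zero, h, one_smul, mul_zero, mul_one, Finset.sum_add_distrib] at e
  rw [defect_eq (by omega), e]
  abel

/-- That span is annihilated by c_n. Hence (u ⊗ c_n)(D_n(X) ⊗ c_n) = 0 for every u, the cancellation
behind closedness. -/
theorem PreservesArcLength.lastCoord_defect (hm : 2 ≤ m) (hX : PreservesArcLength γ X)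
    (h : ∀ n, arcLength γ n = 1) (n : ℤ) : lastCoord γ n (defect γ X n) = 0 := by
  obtain ⟨c, hc⟩ := exists_lastCoord_eq_dotProduct (by omega) γ n
  rw [hX.defect_eq_sum hm h, hc, dotProduct_sum]
  refine Finset.sum_eq_zero fun l hl => ?_
  rw [Finset.mem_range] at hl
  have e : n + ((l + 1 : ℕ) : ℤ) = n + 1 + l := by push_cast; ring
  rw [dotProduct_smul, ← hc, e, lastCoord_vertex γ n (by omega), smul_zero]

/-- With Z fixed only the invariants vary, and their derivatives are the coordinates of D_n(X) in
γ_{n+1}, …, γ_{n+m-1}; M_n(Z) turns those vectors into the corresponding Z's. -/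
theorem PreservesArcLength.hasDerivAt_defect (hm : 2 ≤ m) (hX : PreservesArcLength γ X)
    (h : ∀ n, arcLength γ n = 1) (Z : ℤ → Fin m → ℝ) (n : ℤ) :
    HasDerivAt (fun t : ℝ => defect (fun k => γ k + t • X k) Z n)
      (-(motion γ Z n *ᵥ defect γ X n)) 0 := by
  have e : motion γ Z n *ᵥ defect γ X n =
      ∑ l ∈ Finset.range (m - 1), invariantDeriv γ X n (l + 1) • Z (n + (l + 1 : ℕ)) := by
    rw [hX.defect_eq_sum hm h, Matrix.mulVec_sum]
    refine Finset.sum_congr rfl fun l hl => ?_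
    rw [Finset.mem_range] at hl
    rw [Matrix.mulVec_smul, motion_mulVec h Z n (by omega)]
  rw [e]
  simp only [defect_eq (show 0 < m by omega)]
  exact (HasDerivAt.fun_sum fun l _ =>
    (hasDerivAt_invariant γ X n (l + 1)).smul_const (Z (n + (l + 1 : ℕ)))).const_sub _

/-- The sum of the determinants `|γ_{n+1}, …, X_{n+s}, …, Y_{n+r}, …, γ_{n+m-1}, u|` over
`r ≠ s`. -/
def doubleMixedSum (γ X Y : ℤ → Fin m → ℝ) (u : Fin m → ℝ) (n : ℤ) : ℝ :=
  ∑ r ∈ Finset.range (m - 1), ∑ s ∈ Finset.range (m - 1), if s = r then 0 else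
    vol (Function.update (Function.update (Function.update (fun j => γ (n + 1 + j))
      r (Y (n + 1 + r))) s (X (n + 1 + s))) (m - 1) u)

theorem doubleMixedSum_comm (γ X Y : ℤ → Fin m → ℝ) (u : Fin m → ℝ) (n : ℤ) :
    doubleMixedSum γ X Y u n = doubleMixedSum γ Y X u n := by
  rw [doubleMixedSum, Finset.sum_comm, doubleMixedSum]
  refine Finset.sum_congr rfl fun r _ => Finset.sum_congr rfl fun s _ => ?_
  by_cases hrs : s = r
  · simp [hrs]
  · rw [if_neg hrs, if_neg (Ne.symm hrs), Function.update_comm hrs]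

/-- Column r holds the constant Y_{n+1+r}, so the derivative falls either on another frame column,
giving the double sum, or on u. -/
theorem hasDerivAt_mixedSum (hm : 0 < m) (γ X Y : ℤ → Fin m → ℝ) (n : ℤ) {u : ℝ → Fin m → ℝ}
    {u' : Fin m → ℝ} (hu : HasDerivAt u u' 0) :
    HasDerivAt (fun t : ℝ => mixedSum (fun k => γ k + t • X k) Y (u t) n)
      (doubleMixedSum γ X Y (u 0) n + mixedSum γ Y u' n) 0 := by
  rw [doubleMixedSum, mixedSum, ← Finset.sum_add_distrib]
  refine HasDerivAt.fun_sum fun r hr => ?_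
  rw [Finset.mem_range] at hr
  have hd := hasDerivAt_vol (t := 0) fun j (_ : j < m) =>
    hasDerivAt_update (hasDerivAt_update
      (fun j : ℕ => hasDerivAt_add_smul (γ (n + 1 + j)) (X (n + 1 + j)) 0) r
      (hasDerivAt_const (0 : ℝ) (Y (n + 1 + r)))) (m - 1) hu j
  refine hd.congr_deriv (Eq.symm ?_)
  have hm' : m = (m - 1) + 1 := by omega
  have hsplit : ∀ f : ℕ → ℝ, ∑ j ∈ Finset.range m, f j =
      ∑ j ∈ Finset.range (m - 1), f j + f (m - 1) := by
    intro f
    conv_lhs => rw [hm']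
    exact Finset.sum_range_succ f (m - 1)
  rw [hsplit]
  simp only [zero_smul, add_zero]
  congr 1
  · refine Finset.sum_congr rfl fun s hs => ?_
    rw [Finset.mem_range] at hs
    have hne : s ≠ m - 1 := by omega
    by_cases hsr : s = r
    · rw [if_pos hsr, Function.update_of_ne hne, hsr, Function.update_self,
        vol_update_zero _ (by omega)]
    · rw [if_neg hsr, Function.update_of_ne hne, Function.update_of_ne hsr,
        Function.update_comm hne]
  · simp

/-- The derivative along `X` of the summands of `ω₁`: the double sum is symmetric in `X` and `Y`, so
that only the trace contributes to the exterior derivative. -/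
theorem PreservesArcLength.hasDerivAt_mixedSum_defect (hm : 2 ≤ m) (hX : PreservesArcLength γ X)
    (hY : PreservesArcLength γ Y) (h : ∀ n, arcLength γ n = 1) (Z : ℤ → Fin m → ℝ) (n : ℤ)
    {c : Fin m → ℝ} (hc : ∀ u, lastCoord γ n u = c ⬝ᵥ u) :
    HasDerivAt (fun t : ℝ => mixedSum (fun k => γ k + t • X k) Y
        (defect (fun k => γ k + t • X k) Z n) n)
      (doubleMixedSum γ X Y (defect γ Z n) n +
        (motion γ Y (n + 1) * motion γ Z n * Matrix.vecMulVec (defect γ X n) c).trace) 0 := by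
  have hd := hasDerivAt_mixedSum (by omega) γ X Y n (hX.hasDerivAt_defect hm h Z n)
  rw [mixedSum_neg (by omega), mixedSum_eq_neg_lastCoord (by omega) n
    (hY.trace_motion_eq_zero h (n + 1)) (fun j hj => motion_mulVec h Y (n + 1) hj), neg_neg, hc,
    Matrix.mulVec_mulVec, ← trace_mul_vecMulVec] at hd
  simpa using hd

/-- Of the eight terms of the expansion, those with at least two of a, b, c vanish, after a cyclic
rotation where necessary; only the linear part survives. -/
theorem trace_mul_add_sub_trace_mul {x y z a b c : Matrix (Fin m) (Fin m) ℝ} (hab : a * b = 0)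
    (hbc : b * c = 0) (hca : c * a = 0) :
    ((x + a) * (y + b) * (z + c)).trace - (x * y * z).trace =
      (y * z * a).trace + (z * x * b).trace + (x * y * c).trace := by
  have h1 : (x * b * c).trace = 0 := by rw [Matrix.mul_assoc, hbc]; simp
  have h2 : (a * y * c).trace = 0 := by
    rw [Matrix.trace_mul_comm, ← Matrix.mul_assoc, hca]; simp
  have h3 : (a * b * z).trace = 0 := by rw [hab]; simp
  have h4 : (a * b * c).trace = 0 := by rw [hab]; simp
  have h5 : (a * y * z).trace = (y * z * a).trace := by
    rw [Matrix.mul_assoc, Matrix.trace_mul_comm]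
  have h6 : (x * b * z).trace = (z * x * b).trace := by
    rw [Matrix.trace_mul_comm, ← Matrix.mul_assoc]
  simp only [Matrix.add_mul, Matrix.mul_add, Matrix.trace_add, h1, h2, h3, h4, h5, h6]
  ring

/-- Allows M_{n+1} to be replaced by M_n in the mixed traces: the rank-one correction dies against
the final rank-one factor by cyclicity. -/
theorem trace_add_mul_mul_of_mul_eq_zero {x y a b : Matrix (Fin m) (Fin m) ℝ} (hab : b * a = 0) :
    ((x + a) * y * b).trace = (x * y * b).trace := by
  rw [Matrix.add_mul, Matrix.add_mul, Matrix.trace_add, Matrix.trace_mul_comm (a * y),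
    ← Matrix.mul_assoc, hab]
  simp

end Derivative

/-! ### Closedness -/

section Closed

variable {m N : ℕ} {T : SL(m, ℝ)} {γ X Y Z : ℤ → Fin m → ℝ}

/-- The `n`-th summand of the derivative of `2 ω₁(Y, Z)` along `X`. -/
def omegaDerivSummand (γ X Y Z : ℤ → Fin m → ℝ) (n : ℤ) : ℝ :=
  deriv (fun t : ℝ => mixedSum (fun k => γ k + t • X k) Z
        (defect (fun k => γ k + t • X k) Y n) n -
      mixedSum (fun k => γ k + t • X k) Y (defect (fun k => γ k + t • X k) Z n) n) 0

theorem isTwisted_add_smul (hγ : IsTwisted N T γ) (hX : IsTwisted N T X) (t : ℝ) :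
    IsTwisted N T fun k => γ k + t • X k := fun n => by
  simp only [hγ n, hX n, Matrix.mulVec_add, Matrix.mulVec_smul]

theorem hasDerivAt_omega₁ (hm : 2 ≤ m) (h : ∀ n, arcLength γ n = 1) (hγ : IsTwisted N T γ)
    (hX : IsTwisted N T X) (hY : IsTwisted N T Y) (hZ : IsTwisted N T Z)
    (hX' : PreservesArcLength γ X) (hY' : PreservesArcLength γ Y)
    (hZ' : PreservesArcLength γ Z) :
    HasDerivAt (fun t : ℝ => omega₁ N (fun k => γ k + t • X k) Y Z)
      ((1 / 2) * ∑ n ∈ Finset.Icc (1 : ℤ) N, omegaDerivSummand γ X Y Z n) 0 := by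
  simp only [fun t => omega₁_eq_sum_mixedSum (isTwisted_add_smul hγ hX t) hY hZ]
  refine (HasDerivAt.fun_sum fun n _ => ?_).const_mul _
  obtain ⟨c, hc⟩ := exists_lastCoord_eq_dotProduct (by omega) γ n
  exact ((hX'.hasDerivAt_mixedSum_defect hm hZ' h Y n hc).sub
    (hX'.hasDerivAt_mixedSum_defect hm hY' h Z n hc)).differentiableAt.hasDerivAt

/-- The six double sums cancel in pairs by symmetry. The six traces, once M_{n+1} is replaced by
M_n, are the linear parts of the increments of the two cubic traces; the higher parts vanish. -/
theorem omegaDerivSummand_alternating_sum (hm : 2 ≤ m) (h : ∀ n, arcLength γ n = 1)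
    (hX : PreservesArcLength γ X) (hY : PreservesArcLength γ Y) (hZ : PreservesArcLength γ Z)
    (n : ℤ) :
    omegaDerivSummand γ X Y Z n - omegaDerivSummand γ Y X Z n + omegaDerivSummand γ Z X Y n =
      ((motion γ X (n + 1) * motion γ Z (n + 1) * motion γ Y (n + 1)).trace -
        (motion γ X (n + 1) * motion γ Y (n + 1) * motion γ Z (n + 1)).trace) -
      ((motion γ X n * motion γ Z n * motion γ Y n).trace -
        (motion γ X n * motion γ Y n * motion γ Z n).trace) := by
  obtain ⟨c, hc⟩ := exists_lastCoord_eq_dotProduct (by omega) γ n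
  have key : ∀ {X Y Z : ℤ → Fin m → ℝ}, PreservesArcLength γ X → PreservesArcLength γ Y →
      PreservesArcLength γ Z → omegaDerivSummand γ X Y Z n =
        doubleMixedSum γ X Z (defect γ Y n) n +
        (motion γ Z (n + 1) * motion γ Y n * Matrix.vecMulVec (defect γ X n) c).trace -
        (doubleMixedSum γ X Y (defect γ Z n) n +
        (motion γ Y (n + 1) * motion γ Z n * Matrix.vecMulVec (defect γ X n) c).trace) :=
    fun {X Y Z} hX hY hZ => ((hX.hasDerivAt_mixedSum_defect hm hZ h Y n hc).sub
      (hX.hasDerivAt_mixedSum_defect hm hY h Z n hc)).deriv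
  -- Only the right-hand factor must come from a tangent vector: the product contains the scalar
  -- c_n(D_n(Y)).
  have hzero : ∀ {X Y : ℤ → Fin m → ℝ}, PreservesArcLength γ Y →
      Matrix.vecMulVec (defect γ X n) c * Matrix.vecMulVec (defect γ Y n) c = 0 := by
    intro X Y hY
    rw [Matrix.vecMulVec_mul_vecMulVec, ← hc, hY.lastCoord_defect hm h]
    simp
  rw [key hX hY hZ, key hY hX hZ, key hZ hX hY]
  simp only [fun X => motion_succ hm h X n hc]
  have e1 := trace_mul_add_sub_trace_mul (x := motion γ X n) (y := motion γ Y n)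
    (z := motion γ Z n) (hzero (X := X) hY) (hzero (X := Y) hZ) (hzero (X := Z) hX)
  have e2 := trace_mul_add_sub_trace_mul (x := motion γ X n) (y := motion γ Z n)
    (z := motion γ Y n) (hzero (X := X) hZ) (hzero (X := Z) hY) (hzero (X := Y) hX)
  rw [trace_add_mul_mul_of_mul_eq_zero (hzero hZ), trace_add_mul_mul_of_mul_eq_zero (hzero hY),
    trace_add_mul_mul_of_mul_eq_zero (hzero hZ), trace_add_mul_mul_of_mul_eq_zero (hzero hX),
    trace_add_mul_mul_of_mul_eq_zero (hzero hY), trace_add_mul_mul_of_mul_eq_zero (hzero hX),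
    doubleMixedSum_comm γ Z X, doubleMixedSum_comm γ Z Y, doubleMixedSum_comm γ Y X]
  linarith

theorem trace_motion_mul_periodic (h : ∀ n, arcLength γ n = 1) (hγ : IsTwisted N T γ)
    (hX : IsTwisted N T X) (hY : IsTwisted N T Y) (hZ : IsTwisted N T Z) (n : ℤ) :
    (motion γ X (n + N) * motion γ Y (n + N) * motion γ Z (n + N)).trace =
      (motion γ X n * motion γ Y n * motion γ Z n).trace := by
  have hT : (T⁻¹).1 * T.1 = 1 := by
    rw [← Matrix.SpecialLinearGroup.coe_mul]
    simp
  have e : motion γ X (n + N) * motion γ Y (n + N) * motion γ Z (n + N) =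
      T.1 * (motion γ X n * motion γ Y n * motion γ Z n) * (T⁻¹).1 := by
    simp only [motion_add_period_eq h hγ, hX, hY, hZ]
    calc _ = T.1 * motion γ X n * ((T⁻¹).1 * T.1) * motion γ Y n * ((T⁻¹).1 * T.1) *
          motion γ Z n * (T⁻¹).1 := by simp only [Matrix.mul_assoc]
      _ = _ := by simp only [hT, Matrix.mul_one, Matrix.mul_assoc]
  rw [e, Matrix.trace_mul_comm, ← Matrix.mul_assoc, hT, Matrix.one_mul]

theorem preservesArcLength_mulVec (γ : ℤ → Fin m → ℝ) {A : Matrix (Fin m) (Fin m) ℝ}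
    (hA : A.trace = 0) :
    PreservesArcLength γ fun k => A *ᵥ γ k := by
  intro n
  have h1 := hasDerivAt_vol (v := fun t j => γ (n + j) + t • A *ᵥ γ (n + j)) (t := 0)
    (v' := fun j => A *ᵥ γ (n + j)) fun j _ => hasDerivAt_add_smul _ _ _
  simp only [zero_smul, add_zero] at h1
  rw [sum_vol_update_mulVec (fun j : ℕ => γ (n + j)) A, hA, zero_mul] at h1
  exact h1

end Closed

/-! ### Transfer to the coordinates (ℝᵐ)ᴺ and conclusion -/

theorem hasDerivAt_line {E : Type*} [NormedAddCommGroup E] [NormedSpace ℝ E] {f : E → ℝ} {x : E}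
    (hf : DifferentiableAt ℝ f x) (v : E) :
    HasDerivAt (fun t : ℝ => f (x + t • v)) (fderiv ℝ f x v) 0 :=
  hf.hasFDerivAt.hasLineDerivAt v

section Coordinates

variable {m N : ℕ} [NeZero N] {T : SL(m, ℝ)}

theorem polygon_add_smul (T : SL(m, ℝ)) (x X : Vertices m N) (t : ℝ) :
    polygon T (x + t • X) = fun k => polygon T x k + t • polygon T X k := by
  funext k
  rw [polygon_add, polygon_smul]

theorem differentiable_arcLength_polygon (T : SL(m, ℝ)) (n : ℤ) :
    Differentiable ℝ fun y : Vertices m N => arcLength (polygon T y) n :=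
  (contDiff_vol fun j => contDiff_polygon T (n + j)).differentiable (by simp)

theorem mem_tangent_iff {x X : Vertices m N} :
    X ∈ tangent T x ↔ PreservesArcLength (polygon T x) (polygon T X) := by
  have hd : ∀ n, HasDerivAt (fun t : ℝ => arcLength (fun k => polygon T x k + t • polygon T X k) n)
      (fderiv ℝ (fun y : Vertices m N => arcLength (polygon T y) n) x X) 0 := by
    intro n
    have := hasDerivAt_line (differentiable_arcLength_polygon T n x) X
    simpa only [polygon_add_smul] using this
  refine ⟨fun h n => ?_, fun h n => (hd n).unique (h n)⟩
  have := hd n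
  rwa [h n] at this

theorem fderiv_omega₁Form (hm : 2 ≤ m) {x X Y Z : Vertices m N}
    (hx : polygon T x ∈ arcLengthPolygons N T) (hX : X ∈ tangent T x) (hY : Y ∈ tangent T x)
    (hZ : Z ∈ tangent T x) :
    fderiv ℝ (fun y => omega₁Form T y ![Y, Z]) x X =
      (1 / 2) * ∑ n ∈ Finset.Icc (1 : ℤ) N,
        omegaDerivSummand (polygon T x) (polygon T X) (polygon T Y) (polygon T Z) n := by
  have hd : DifferentiableAt ℝ
      (fun y : Vertices m N => omega₁ N (polygon T y) (polygon T Y) (polygon T Z)) x :=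
    (contDiff_omega₁ N (X := fun _ => polygon T Y) (Y := fun _ => polygon T Z)
      (contDiff_polygon T) (fun _ => contDiff_const) (fun _ => contDiff_const)).differentiable
      (by simp) x
  have h1 := hasDerivAt_omega₁ hm hx.2 hx.1 (isTwisted_polygon T X) (isTwisted_polygon T Y)
    (isTwisted_polygon T Z) (mem_tangent_iff.1 hX) (mem_tangent_iff.1 hY) (mem_tangent_iff.1 hZ)
  simp only [← polygon_add_smul] at h1
  exact (hasDerivAt_line hd X).unique h1

/-- The exterior derivative is the alternating sum of three directional derivatives with the
remaining arguments held constant, hence half a sum over one period of increments of a periodic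
function. -/
theorem extDeriv_omega₁Form_eq_zero (hm : 2 ≤ m) {x X Y Z : Vertices m N}
    (hx : polygon T x ∈ arcLengthPolygons N T) (hX : X ∈ tangent T x) (hY : Y ∈ tangent T x)
    (hZ : Z ∈ tangent T x) : extDeriv (omega₁Form T) x ![X, Y, Z] = 0 := by
  have h0 : (0 : Fin 3).removeNth ![X, Y, Z] = ![Y, Z] := by
    ext i; fin_cases i <;> rfl
  have h1 : (1 : Fin 3).removeNth ![X, Y, Z] = ![X, Z] := by
    ext i; fin_cases i <;> rfl
  have h2 : (2 : Fin 3).removeNth ![X, Y, Z] = ![X, Y] := by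
    ext i; fin_cases i <;> rfl
  rw [extDeriv_apply ((contDiff_omega₁Form T).differentiable (by simp) x), Fin.sum_univ_three,
    h0, h1, h2]
  have ht := sum_Icc_telescope_of_periodic (N := N) (f := fun n =>
    (motion (polygon T x) (polygon T X) n * motion (polygon T x) (polygon T Z) n *
        motion (polygon T x) (polygon T Y) n).trace -
      (motion (polygon T x) (polygon T X) n * motion (polygon T x) (polygon T Y) n *
        motion (polygon T x) (polygon T Z) n).trace) fun n => by
      simp only [trace_motion_mul_periodic hx.2 hx.1, isTwisted_polygon]
  simp only [← omegaDerivSummand_alternating_sum hm hx.2 (mem_tangent_iff.1 hX)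
    (mem_tangent_iff.1 hY) (mem_tangent_iff.1 hZ), Finset.sum_add_distrib,
    Finset.sum_sub_distrib] at ht
  have e1 := fderiv_omega₁Form hm hx hX hY hZ
  have e2 := fderiv_omega₁Form hm hx hY hX hZ
  have e3 := fderiv_omega₁Form hm hx hZ hX hY
  simp only [Matrix.cons_val_zero, Matrix.cons_val_one, Matrix.cons_val, e1, e2, e3]
  simp
  linarith

theorem exists_mem_ker_omega₁Form (hm : 2 ≤ m) {x : Vertices m N}
    (hx : polygon T x ∈ arcLengthPolygons N T) :
    ∃ X ∈ tangent T x, X ≠ 0 ∧ ∀ Y, omega₁Form T x ![X, Y] = 0 := by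
  obtain ⟨A, hA0, hA, hAT⟩ := exists_traceless_commute hm T.1
  have hX : IsTwisted N T fun k => A *ᵥ polygon T x k := fun n => by
    simp only [hx.1 n, Matrix.mulVec_mulVec, hAT]
  have e := hX.eq_polygon
  refine ⟨_, mem_tangent_iff.2 (e ▸ preservesArcLength_mulVec _ hA), ?_, fun Y => ?_⟩
  · intro h0
    rw [h0] at e
    -- If all vertices of X vanish, A kills the frame at 0, which is a basis, so A = 0.
    refine hA0 (matrix_ext_of_frame hx.2 0 fun j _ => ?_)
    have := congrFun e (0 + j)
    simpa [polygon] using this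
  · change omega₁ N (polygon T x) (polygon T _) (polygon T Y) = 0
    exact e ▸ omega₁_mulVec_eq_zero hm hx.2 hx.1 (isTwisted_polygon T Y) hA hAT

end Coordinates

end CentroAffine

end

theorem mainTheorem4 (m N : ℕ) [NeZero N] (hm : 2 ≤ m) (hNm : Nat.Coprime N m)
    (T : Matrix.SpecialLinearGroup (Fin m) ℝ) :
    -- `ω₁` is closed on the manifold of arc length parametrized polygons
    (∀ x : CentroAffine.Vertices m N,
      CentroAffine.polygon T x ∈ CentroAffine.arcLengthPolygons N T →
      ∀ X ∈ CentroAffine.tangent T x, ∀ Y ∈ CentroAffine.tangent T x,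
        ∀ Z ∈ CentroAffine.tangent T x,
          extDeriv (CentroAffine.omega₁Form T) x ![X, Y, Z] = 0) ∧
    -- and its kernel is non-trivial at each point
    (∀ x : CentroAffine.Vertices m N,
      CentroAffine.polygon T x ∈ CentroAffine.arcLengthPolygons N T →
      ∃ X ∈ CentroAffine.tangent T x, X ≠ 0 ∧
        ∀ Y ∈ CentroAffine.tangent T x, CentroAffine.omega₁Form T x ![X, Y] = 0) := by
  exact ⟨fun _ hx _ hX _ hY _ hZ => CentroAffine.extDeriv_omega₁Form_eq_zero hm hx hX hY hZ,
    fun _ hx => (CentroAffine.exists_mem_ker_omega₁Form hm hx).imp fun _ h =>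
      ⟨h.1, h.2.1, fun Y _ => h.2.2 Y⟩⟩
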